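/- Let $F=\mathbf Z/2$, let $S$ be a finite set, and let $V$ be an $F$-vector space with basis $(e_s)_{s\in S}$ and an alternating bilinear form $\langle\,,\rangle$ such that the graph on $S$, in which $s\ne s'$ are joined iff $\langle e_s,e_{s'}\rangle=1$, is a cycle with $N$ vertices, where $N\ge 3$ is odd. Let $\bar V=V/Fe_S$, where $e_S=\sum_{s\in S}e_s$, with the induced form, and let $\bar e_s$ be the image of $e_s$. The graph on $S$ attached in the same way to $\bar V$ and $(\bar e_s)$ is this same cycle. Put $\bar e_I=\sum_{s\in I}\bar e_s$ for $I\subset S$. Let $\mathcal I^1$ be the set of all $I\subset S$ such that $|I|$ is odd and the full subgraph on $I$ is a path with at least one vertex. For $I,I'\in\mathcal I^1$ write $I\prec I'$ if $I\subsetneq I'$ and the full subgraph on $I'\setminus I$ is disconnected, and write $I\spadesuit I'$ if $I\cap I'=\emptyset$ and the full subgraph on $I\cup I'$ is disconnected. Let $I^{ev}$ be the set of $s\in I$ such that $I\setminus\{s\}=I'\sqcup I''$ for some $I',I''\in\mathcal I^1$ with $I'\spadesuit I''$. Let $\phi(\bar V)$ be the set of finite subsets $B$ of $\mathcal I^1$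 such that $(P_0)$ any $I,I'\in B$ satisfy $I=I'$, $I\spadesuit I'$, $I\prec I'$ or $I'\prec I$; $(P_1)$ for any $I\in B$ there are pairwise disjoint $I_1,\dots,I_k\in B$ ($k\ge 0$) with $I_j\prec I$ for all $j$ and $I^{ev}\subset I_1\cup\dots\cup I_k$. For $B\in\phi(\bar V)$ and $s\in S$ let $g_s(B)=|\{I\in B: s\in I\}|$, and let $\bar\varepsilon(B)=\sum_{s\in S}\tfrac12 g_s(B)(g_s(B)+1)\,\bar e_s\in\bar V$. Fix an edge $\mathbf e=\{\tau,\tau'\}$ of the graph and let $n_B=|\{I\in B:\mathbf e\subset I\}|$. If $B\in\phi(\bar V)$ and some member of $B$ meets $\mathbf e$, then there is a unique $I_B\in B$ with $|I_B\cap\mathbf e|=1$. For $B\in\phi(\bar V)$ put $B^!=B\setminus\{I_B\}$ if $n_B$ is odd and $B^!=B$ if $n_B$ is even. The map $B\mapsto B^!$ is injective on $\phi(\bar V)$. Let $\omega(\bar V)=\{B^!: B\in\phi(\bar V)\}$. For $B\in\omega(\bar V)$ let $\tilde B\in\phi(\bar V)$ be the element with $\tilde B^!=B$, let ${}'\varepsilon(B)=\bar\varepsilon(\tilde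 B)$, and let $\langle B\rangle$ be the subspace of $\bar V$ spanned by $\{\bar e_I: I\in B\}$. For $B',B\in\omega(\bar V)$ write $B'\preceq B$ if for some $k\ge 0$ there is a sequence $B'=B_0,B_1,\dots,B_k=B$ in $\omega(\bar V)$ with ${}'\varepsilon(B_{i-1})\in\langle B_i\rangle$ for $i=1,\dots,k$. Then $\preceq$ is a partial order on $\omega(\bar V)$. -/

import Mathlib

namespace CircularFamily

section Graph

variable {S : Type*} [DecidableEq S]

/-- The full subgraph on the vertex set `I` is a graph of type `A_m` for some `m ≥ 1`. -/
def IsTypeA (G : SimpleGraph S) (I : Finset S) : Prop :=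
  ∃ m : ℕ, 1 ≤ m ∧ Nonempty (G.induce (I : Set S) ≃g SimpleGraph.pathGraph m)

/-- The set `𝓘¹`: vertex sets of full subgraphs of type `A_m` with `m` odd. -/
def oddPaths (G : SimpleGraph S) : Set (Finset S) :=
  {I | IsTypeA G I ∧ Odd I.card}

/-- `I ≺ I'`: strict inclusion such that the full subgraph on `I' - I` is disconnected. -/
def Prec (G : SimpleGraph S) (I I' : Finset S) : Prop :=
  I ⊂ I' ∧ ¬ (G.induce ((I' \ I : Finset S) : Set S)).Connected

/-- `I ♠ I'`: disjoint, and the full subgraph on `I ∪ I'` is disconnected. -/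
def Spade (G : SimpleGraph S) (I I' : Finset S) : Prop :=
  Disjoint I I' ∧ ¬ (G.induce ((I ∪ I' : Finset S) : Set S)).Connected

/-- `I^{ev}`: the `s ∈ I` such that `I - {s} = I' ⊔ I''` with `I', I'' ∈ 𝓘¹` and `I' ♠ I''`. -/
def evPart (G : SimpleGraph S) (I : Finset S) : Set S :=
  {s | s ∈ I ∧ ∃ I' ∈ oddPaths G, ∃ I'' ∈ oddPaths G, Spade G I' I'' ∧ I.erase s = I' ∪ I''}

/-- Property `(P₀)`. -/
def P0 (G : SimpleGraph S) (B : Finset (Finset S)) : Prop :=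
  ∀ I ∈ B, ∀ I' ∈ B, I = I' ∨ Spade G I I' ∨ Prec G I I' ∨ Prec G I' I

/-- Property `(P₁)`: for every `I ∈ B`, the set `I^{ev}` is contained in a disjoint union of
members `J` of `B` with `J ≺ I`. -/
def P1 (G : SimpleGraph S) (B : Finset (Finset S)) : Prop :=
  ∀ I ∈ B, ∃ C : Finset (Finset S), C ⊆ B ∧ (∀ J ∈ C, Prec G J I) ∧
    (C : Set (Finset S)).PairwiseDisjoint id ∧ evPart G I ⊆ ⋃ J ∈ C, (J : Set S)

/-- The set `φ` of all finite subsets `B` of `𝓘¹` that satisfy `(P₀)` and `(P₁)`. -/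
def phi (G : SimpleGraph S) : Set (Finset (Finset S)) :=
  {B | (∀ I ∈ B, I ∈ oddPaths G) ∧ P0 G B ∧ P1 G B}

/-- `g_s(B)`, the number of members of `B` containing `s`. -/
def gCount (B : Finset (Finset S)) (s : S) : ℕ :=
  (B.filter fun I => s ∈ I).card

/-- `n_B`, the number of members of `B` containing the edge `ed`. -/
def nCount (ed : Finset S) (B : Finset (Finset S)) : ℕ :=
  (B.filter fun I => ed ⊆ I).card

/-- The support of `B`, the union of its members. -/
def supp (B : Finset (Finset S)) : Finset S :=
  B.biUnion id

/-- `B^!`: for odd `n_B` remove from `B` its (unique) member `I_B` with `|I_B ∩ ed| = 1`;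
otherwise `B^! = B`. -/
def bang (ed : Finset S) (B : Finset (Finset S)) : Finset (Finset S) :=
  if Odd (nCount ed B) then B \ B.filter (fun I => (I ∩ ed).card = 1) else B

/-- The set `ω = {B^! ; B ∈ φ}`. -/
def omega (G : SimpleGraph S) (ed : Finset S) : Set (Finset (Finset S)) :=
  bang ed '' phi G

/-- For `B ∈ ω`, the element `B̃ ∈ φ` with `B̃^! = B`. -/
noncomputable def tilde (G : SimpleGraph S) (ed : Finset S) (B : omega G ed) :
    Finset (Finset S) :=
  B.2.choose

theorem tilde_mem (G : SimpleGraph S) (ed : Finset S) (B : omega G ed) :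
    tilde G ed B ∈ phi G :=
  B.2.choose_spec.1

theorem bang_tilde (G : SimpleGraph S) (ed : Finset S) (B : omega G ed) :
    bang ed (tilde G ed B) = B :=
  B.2.choose_spec.2

end Graph

section Vectors

variable {S W : Type*} [AddCommGroup W] [Module (ZMod 2) W]

/-- The graph with vertex set `S` in which `s ≠ s'` are joined when `⟨e_s, e_{s'}⟩ = 1`
(the form is symmetric in all uses). -/
def edgeGraph (β : LinearMap.BilinForm (ZMod 2) W) (e : S → W) : SimpleGraph S :=
  SimpleGraph.fromRel fun s s' => β (e s) (e s') = 1

/-- `e_I = ∑_{s ∈ I} e_s`. -/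
def vec (e : S → W) (I : Finset S) : W :=
  ∑ s ∈ I, e s

/-- The subspace spanned by the `e_I`, `I ∈ B`. -/
def spanOf (e : S → W) (B : Finset (Finset S)) : Submodule (ZMod 2) W :=
  Submodule.span (ZMod 2) (vec e '' (B : Set (Finset S)))

/-- `ε(B) = ∑_s ε_s(B) e_s`, where `ε_s(B) = g_s(B) (g_s(B) + 1) / 2` modulo `2`. -/
def eps [Fintype S] [DecidableEq S] (e : S → W) (B : Finset (Finset S)) : W :=
  ∑ s : S, ((gCount B s * (gCount B s + 1) / 2 : ℕ) : ZMod 2) • e s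

/-- The map `'ε : ω → W`, `'ε(B) = ε(B̃)`. -/
noncomputable def epsPrime [Fintype S] [DecidableEq S] (e : S → W) (G : SimpleGraph S)
    (ed : Finset S) (B : omega G ed) : W :=
  eps e (tilde G ed B)

/-- `B' ⪯ B` on `ω`: there is a sequence `B' = B_0, B_1, …, B_k = B` in `ω` such that
`'ε(B_i) ∈ ⟨B_{i+1}⟩` for all `i < k`. -/
def PrecEq [Fintype S] [DecidableEq S] (e : S → W) (G : SimpleGraph S) (ed : Finset S)
    (B' B : omega G ed) : Prop :=
  ∃ (k : ℕ) (c : ℕ → omega G ed), c 0 = B' ∧ c k = B ∧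
    ∀ i < k, epsPrime e G ed (c i) ∈ spanOf e (c (i + 1) : Finset (Finset S))

end Vectors

section Affine

variable {S V : Type*} [Fintype S] [AddCommGroup V] [Module (ZMod 2) V]

/-- `V` has the basis `e_s`, `s ∈ S`, and an alternating form whose graph on `S` is of affine
type `A_{N-1}` with `N ≥ 3` odd, that is, a cycle with `N` vertices. -/
structure IsAffineA (β : LinearMap.BilinForm (ZMod 2) V) (e : Module.Basis S (ZMod 2) V) :
    Prop where
  isAlt : β.IsAlt
  isCycle : ∃ N : ℕ, 3 ≤ N ∧ Odd N ∧ Nonempty (edgeGraph β e ≃g SimpleGraph.cycleGraph N)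

variable {β : LinearMap.BilinForm (ZMod 2) V} {e : Module.Basis S (ZMod 2) V}

/-- The line `F e_S`. -/
def line (e : Module.Basis S (ZMod 2) V) : Submodule (ZMod 2) V :=
  Submodule.span (ZMod 2) {vec e Finset.univ}

theorem IsAffineA.line_le_ker (h : IsAffineA β e) : line e ≤ LinearMap.ker β := by
  classical
  rw [line, Submodule.span_singleton_le_iff_mem, LinearMap.mem_ker]
  refine e.ext fun t => ?_
  obtain ⟨N, hN, -, ⟨f⟩⟩ := h.isCycle
  have hval : ∀ s, β (e s) (e t) = if (edgeGraph β e).Adj t s then 1 else 0 := by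
    intro s
    have hsymm : β (e s) (e t) = β (e t) (e s) := by
      rw [← LinearMap.IsAlt.neg h.isAlt (e t) (e s), ZMod.neg_eq_self_mod_two]
    by_cases hst : t = s
    · subst hst
      simp [h.isAlt (e t)]
    · have h01 : ∀ x : ZMod 2, x = if x = 1 then 1 else 0 := by decide
      rw [edgeGraph, SimpleGraph.fromRel_adj, hsymm, or_self]
      simpa [hst] using h01 _
  have hdeg : (edgeGraph β e).degree t = 2 := by
    obtain ⟨n, rfl⟩ := Nat.exists_eq_add_of_le' hN
    rw [← f.degree_eq t, SimpleGraph.cycleGraph_degree_three_le]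
  have hsum : β (vec e Finset.univ) (e t) = ((edgeGraph β e).degree t : ZMod 2) := by
    rw [vec, map_sum, LinearMap.sum_apply, Finset.sum_congr rfl fun s _ => hval s,
      Finset.sum_boole, ← SimpleGraph.card_neighborFinset_eq_degree]
    congr 2
    ext s
    simp
  rw [hsum, hdeg, LinearMap.zero_apply]
  decide

/-- The quotient `V̄ = V / F e_S`. -/
abbrev Bar (e : Module.Basis S (ZMod 2) V) : Type _ := V ⧸ line e

/-- The form on `V̄` induced by the form of `V`. -/
def IsAffineA.barForm (h : IsAffineA β e) : LinearMap.BilinForm (ZMod 2) (Bar e) :=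
  LinearMap.IsRefl.liftQ₂ β (line e) h.isAlt.isRefl h.line_le_ker

theorem IsAffineA.barForm_mk (h : IsAffineA β e) (x y : V) :
    h.barForm (Submodule.Quotient.mk x) (Submodule.Quotient.mk y) = β x y := rfl

/-- The vectors `ē_s = π(e_s)` of `V̄`. -/
noncomputable def barVec (e : Module.Basis S (ZMod 2) V) (s : S) : Bar e :=
  Submodule.Quotient.mk (e s)

/-- The graph on `S` attached to `V̄`, its form and the vectors `ē_s`. -/
noncomputable def IsAffineA.graph (h : IsAffineA β e) : SimpleGraph S :=
  edgeGraph h.barForm (barVec e)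

end Affine

end CircularFamily

open CircularFamily

/-! A member `B` of `phi G` is a laminar family of odd arcs on the cycle, comparable arcs being
nested with the smaller one in the interior of the larger. It is governed by its depth function
`gCount B`. By (P₁) every edge meeting the support is cut by some member (`exists_cut`), by (P₀) by
only one (`cut_unique`). So along an edge the depth changes by exactly 1 unless it vanishes at both
ends, and the depth function determines `B` (`subset_of_gCount_eq`). Antisymmetry follows once ε(B')
∈ ⟨B⟩ is shown to force `gCount B' ≤ gCount B` pointwise (`gCount_le`).

In coordinates the membership says that `tri (gCount B' s)` is a constant, coming from the line
spanned by e_S, plus the sum of coefficients `f I` over the members `I` of `B` through `s`. Across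
an edge only the member cutting it contributes a jump. Since `tri` separates the depths n - 1 and n
+ 1, the depth of `B'` agrees just before and just after each arc of `B` (`gCount_pred_eq_end`), and
is constant on the part of an arc not covered by smaller members (`gCount_eq_start`). Off the
support of `B` it vanishes, by a parity count once round the odd cycle (`gCount_eq_zero`). Entering
an arc of `B` raises the depth of `B'` by at most 1 and that of `B` by exactly 1, which gives the
inequality.

Injectivity of `bang` is also a parity argument: inside an arc of `B` the depth alternates in
parity, so the parities recover the removed member (`eq_of_insert_mem_phi`). -/

namespace CircularFamily

/-! ### Arcs of an odd cycle as images of integer intervals. -/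

section Cycle

variable {S : Type*}

/-- A periodic parametrization by `ℤ` of a graph that is a cycle with `N` vertices, `N` odd. -/
structure CycleParam (G : SimpleGraph S) (N : ℕ) (p : ℤ → S) : Prop where
  three_le : 3 ≤ N
  odd : Odd N
  surj : Function.Surjective p
  eq_iff : ∀ i j, p i = p j ↔ (N : ℤ) ∣ j - i
  adj_iff : ∀ i j, G.Adj (p i) (p j) ↔ p j = p (i + 1) ∨ p i = p (j + 1)

theorem exists_cycleParam {G : SimpleGraph S} {N : ℕ} (h3 : 3 ≤ N) (hodd : Odd N)
    (f : G ≃g SimpleGraph.cycleGraph N) : ∃ p, CycleParam G N p := by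
  obtain ⟨n, rfl⟩ := Nat.exists_eq_add_of_le' (show 2 ≤ N by omega)
  let q : ℤ → ZMod (n + 2) := fun i => (i : ZMod (n + 2))
  let p : ℤ → S := fun i => f.symm (q i)
  have hp : ∀ i j, p i = p j ↔ q i = q j := fun i j => f.symm.injective.eq_iff
  refine ⟨p, h3, hodd, ?_, ?_, ?_⟩
  · exact f.symm.surjective.comp ZMod.intCast_surjective
  · intro i j
    rw [hp, ← ZMod.intCast_eq_intCast_iff_dvd_sub]
  · intro i j
    have h1 : G.Adj (p i) (p j) ↔ (SimpleGraph.cycleGraph (n + 2)).Adj (q i) (q j) :=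
      f.symm.map_adj_iff
    have h2 : (SimpleGraph.cycleGraph (n + 2)).Adj (q i) (q j) ↔ q i - q j = 1 ∨ q j - q i = 1 :=
      SimpleGraph.cycleGraph_adj
    rw [h1, h2, hp, hp, or_comm, sub_eq_iff_eq_add', sub_eq_iff_eq_add']
    simp only [q, Int.cast_add, Int.cast_one]

namespace CycleParam

variable {G : SimpleGraph S} {N : ℕ} {p : ℤ → S}

theorem add_period (hp : CycleParam G N p) (x : ℤ) : p (x + N) = p x :=
  (hp.eq_iff _ _).2 ⟨-1, by ring⟩

theorem add_mul_period (hp : CycleParam G N p) (x m : ℤ) : p (x + N * m) = p x :=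
  (hp.eq_iff _ _).2 ⟨-m, by ring⟩

theorem eq_of_lt (hp : CycleParam G N p) {x y : ℤ} (h : p x = p y) (h1 : x - y < N)
    (h2 : y - x < N) : x = y := by
  rw [hp.eq_iff] at h
  have := Int.eq_zero_of_abs_lt_dvd h (abs_lt.2 ⟨by omega, by omega⟩)
  omega

theorem adj_succ (hp : CycleParam G N p) (x : ℤ) : G.Adj (p x) (p (x + 1)) :=
  (hp.adj_iff _ _).2 (Or.inl rfl)

theorem adj_pred (hp : CycleParam G N p) (x : ℤ) : G.Adj (p (x - 1)) (p x) := by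
  simpa using hp.adj_succ (x - 1)

theorem eq_or_eq_of_adj (hp : CycleParam G N p) {x : ℤ} {t : S} (h : G.Adj (p x) t) :
    t = p (x + 1) ∨ t = p (x - 1) := by
  obtain ⟨y, rfl⟩ := hp.surj t
  rcases (hp.adj_iff _ _).1 h with h | h
  · exact Or.inl h
  · refine Or.inr ?_
    rw [hp.eq_iff] at h ⊢
    obtain ⟨m, hm⟩ := h
    exact ⟨-m, by linarith⟩

theorem neg (hp : CycleParam G N p) : CycleParam G N fun x => p (-x) where
  three_le := hp.three_le
  odd := hp.odd
  surj := hp.surj.comp neg_surjective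
  eq_iff i j := by
    rw [hp.eq_iff, ← dvd_neg]
    ring_nf
  adj_iff i j := by
    rw [G.adj_comm, hp.adj_iff]
    have key : ∀ x y, p x = p (y + 1) ↔ p (x - 1) = p y := by
      intro x y
      rw [hp.eq_iff, hp.eq_iff]
      ring_nf
    rw [key, key]
    ring_nf
    rw [eq_comm, @eq_comm _ (p (-1 - j))]

/-- Of the two neighbours of a vertex one has just been left, so injectivity forces the path to
continue in the direction of its first step. -/
theorem path_eq (hp : CycleParam G N p) {m : ℕ} {v : ℕ → S} {x : ℤ}
    (hinj : ∀ i j, i < m → j < m → v i = v j → i = j)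
    (hadj : ∀ i, i + 1 < m → G.Adj (v i) (v (i + 1)))
    (h0 : v 0 = p x) (h1 : 1 < m → v 1 = p (x + 1)) :
    ∀ i, i < m → v i = p (x + i) := by
  intro i
  induction i using Nat.twoStepInduction with
  | zero => intro _; simpa using h0
  | one => intro h; simpa using h1 h
  | more i ih1 ih2 =>
    intro hi
    have h := hadj (i + 1) hi
    rw [ih2 (by omega)] at h
    rcases hp.eq_or_eq_of_adj h with h | h
    · rw [h]
      congr 1
      push_cast
      ring
    · exfalso
      have h' : v (i + 2) = v i := by
        rw [ih1 (by omega), h]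
        congr 1
        push_cast
        ring
      have := hinj _ _ hi (by omega) h'
      omega

end CycleParam

variable [DecidableEq S]

/-- The image of the integer interval `[a, a + k)`. -/
def arc (p : ℤ → S) (a : ℤ) (k : ℕ) : Finset S :=
  (Finset.range k).image fun i : ℕ => p (a + i)

theorem mem_arc {p : ℤ → S} {a : ℤ} {k : ℕ} {s : S} :
    s ∈ arc p a k ↔ ∃ i : ℕ, i < k ∧ p (a + i) = s := by
  simp [arc]

theorem mem_arc_of_le {p : ℤ → S} {a x : ℤ} {k : ℕ} (h1 : a ≤ x) (h2 : x < a + k) :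
    p x ∈ arc p a k :=
  mem_arc.2 ⟨(x - a).toNat, by omega, by congr 1; omega⟩

theorem arc_neg (p : ℤ → S) (a : ℤ) (k : ℕ) :
    arc (fun x => p (-x)) a k = arc p (1 - a - k) k := by
  ext s
  rw [mem_arc, mem_arc]
  constructor
  · rintro ⟨i, hi, rfl⟩
    exact ⟨k - 1 - i, by omega, by congr 1; omega⟩
  · rintro ⟨i, hi, rfl⟩
    exact ⟨k - 1 - i, by omega, by congr 1; omega⟩

namespace CycleParam

variable {G : SimpleGraph S} {N : ℕ} {p : ℤ → S}

theorem mem_arc_iff (hp : CycleParam G N p) {a x : ℤ} {k : ℕ} (hk : k ≤ N) (h1 : a ≤ x)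
    (h2 : x < a + N) : p x ∈ arc p a k ↔ x < a + k := by
  refine ⟨fun h => ?_, fun h => mem_arc_of_le h1 h⟩
  obtain ⟨i, hi, h⟩ := mem_arc.1 h
  have := hp.eq_of_lt h (by omega) (by omega)
  omega

theorem arc_add_mul (hp : CycleParam G N p) (a m : ℤ) (k : ℕ) :
    arc p (a + N * m) k = arc p a k := by
  unfold arc
  refine Finset.image_congr fun i _ => ?_
  show p (a + N * m + i) = p (a + i)
  rw [← hp.add_mul_period (a + i) m]
  congr 1
  ring

/-- An arc can be given a starting point in any window of length `N`. -/
theorem exists_start (hp : CycleParam G N p) {s : S} (b : ℤ) :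
    ∃ x, b ≤ x ∧ x < b + N ∧ p x = s ∧ ∀ y k, p y = s → arc p y k = arc p x k := by
  have hN := hp.three_le
  obtain ⟨y, rfl⟩ := hp.surj s
  have h0 := Int.emod_nonneg (y - b) (show (N : ℤ) ≠ 0 by omega)
  have h1 := Int.emod_lt_of_pos (y - b) (show (0 : ℤ) < N by omega)
  have h2 := Int.emod_add_mul_ediv (y - b) N
  have hx : p (b + (y - b) % N) = p y := by
    rw [hp.eq_iff]
    exact ⟨(y - b) / N, by linarith⟩
  refine ⟨b + (y - b) % N, by omega, by omega, hx, fun z k hz => ?_⟩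
  obtain ⟨m, hm⟩ := (hp.eq_iff _ _).1 (hz.trans hx.symm)
  rw [← hp.arc_add_mul z m]
  congr 1
  linarith

/-- An arc through `p x` can be given as the image of an interval through `x`. -/
theorem exists_arc_through (hp : CycleParam G N p) {a x : ℤ} {k : ℕ} (h : p x ∈ arc p a k) :
    ∃ a', arc p a k = arc p a' k ∧ a' ≤ x ∧ x < a' + k := by
  obtain ⟨i, hi, h⟩ := mem_arc.1 h
  obtain ⟨m, hm⟩ := (hp.eq_iff _ _).1 h
  refine ⟨a + N * m, (hp.arc_add_mul _ _ _).symm, by omega, by omega⟩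

/-- The full subgraph on an arc that is not the whole cycle is a path. -/
theorem isTypeA_arc (hp : CycleParam G N p) {a : ℤ} {k : ℕ} (h1 : 1 ≤ k) (hk : k < N) :
    IsTypeA G (arc p a k) := by
  refine ⟨k, h1, ⟨SimpleGraph.Iso.symm ⟨Equiv.ofBijective
    (fun i : Fin k => ⟨p (a + i), Finset.mem_coe.2 (mem_arc_of_le (by omega) (by omega))⟩)
    ⟨?_, ?_⟩, ?_⟩⟩⟩
  · intro i j hij
    have h := hp.eq_of_lt (congrArg Subtype.val hij) (by omega) (by omega)
    exact Fin.ext (by omega)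
  · rintro ⟨s, hs⟩
    obtain ⟨i, hi, rfl⟩ := mem_arc.1 (Finset.mem_coe.1 hs)
    exact ⟨⟨i, hi⟩, rfl⟩
  · intro i j
    show G.Adj (p (a + i)) (p (a + j)) ↔ _
    rw [hp.adj_iff, SimpleGraph.pathGraph_adj]
    constructor
    · rintro (h | h)
      · have := hp.eq_of_lt h (by omega) (by omega)
        omega
      · have := hp.eq_of_lt h (by omega) (by omega)
        omega
    · rintro (h | h)
      · exact Or.inl (by congr 1; omega)
      · exact Or.inr (by congr 1; omega)

theorem connected_arc (hp : CycleParam G N p) {a : ℤ} {k : ℕ} (h1 : 1 ≤ k) (hk : k < N) :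
    (G.induce (arc p a k : Set S)).Connected := by
  obtain ⟨m, hm, ⟨f⟩⟩ := hp.isTypeA_arc (a := a) h1 hk
  obtain ⟨n, rfl⟩ := Nat.exists_eq_add_of_le' hm
  exact f.connected_iff.2 (SimpleGraph.pathGraph_connected n)

theorem card_arc (hp : CycleParam G N p) {a : ℤ} {k : ℕ} (hk : k ≤ N) :
    (arc p a k).card = k := by
  rw [arc, Finset.card_image_of_injOn, Finset.card_range]
  intro i hi j hj h
  have hi' := Finset.mem_range.1 (Finset.mem_coe.1 hi)
  have hj' := Finset.mem_range.1 (Finset.mem_coe.1 hj)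
  have := hp.eq_of_lt h (by omega) (by omega)
  omega

theorem exists_arc_of_path (hp : CycleParam G N p) {m : ℕ} {v : ℕ → S}
    (hinj : ∀ i j, i < m → j < m → v i = v j → i = j)
    (hadj : ∀ i, i + 1 < m → G.Adj (v i) (v (i + 1)))
    (hclosed : ∀ i, i < m → G.Adj (v i) (v 0) → i = 1) :
    m < N ∧ ∃ a, (Finset.range m).image v = arc p a m := by
  have main : ∀ {q : ℤ → S}, CycleParam G N q → ∀ {x}, v 0 = q x →
      (1 < m → v 1 = q (x + 1)) → m < N ∧ (Finset.range m).image v = arc q x m := by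
    intro q hq x h0 h1
    have h := hq.path_eq hinj hadj h0 h1
    have h3 := hq.three_le
    refine ⟨?_, Finset.image_congr fun i hi => h i (Finset.mem_range.1 hi)⟩
    by_contra hlt
    -- A path with `N` vertices would close up: its vertex `N - 1` is adjacent to vertex 0, which
    -- `hclosed` allows only for index 1.
    have := hclosed (N - 1) (by omega) (by
      rw [h _ (by omega), h0, ← hq.add_period x]
      convert hq.adj_succ _ using 2
      omega)
    omega
  obtain ⟨x, hx⟩ := hp.surj (v 0)
  by_cases h1 : 1 < m → v 1 = p (x + 1)
  · exact ⟨(main hp hx.symm h1).1, x, (main hp hx.symm h1).2⟩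
  · push Not at h1
    -- The path runs backwards; the reflected parametrization makes it run forwards.
    have h2 : v 1 = p (x - 1) := by
      have h := hadj 0 h1.1
      rw [← hx] at h
      exact (hp.eq_or_eq_of_adj h).resolve_left h1.2
    obtain ⟨h3, h4⟩ := main hp.neg (x := -x) (by simp [hx]) fun _ => by
      rw [h2]
      congr 1
      ring
    exact ⟨h3, _, h4.trans (arc_neg _ _ _)⟩

/-- Turns induced paths into integer intervals, so that later incidence questions become linear
arithmetic. -/
theorem mem_oddPaths_iff (hp : CycleParam G N p) {I : Finset S} :
    I ∈ oddPaths G ↔ ∃ a k, Odd k ∧ k < N ∧ I = arc p a k := by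
  constructor
  · rintro ⟨⟨m, hm, ⟨f⟩⟩, hodd⟩
    -- The `min` only makes `v` total; indices from `m` on are never used.
    let v : ℕ → S := fun i => (f.symm ⟨min i (m - 1), by omega⟩ : (I : Set S))
    have hv : ∀ i, i < m → ∀ j, j < m → (G.Adj (v i) (v j) ↔ i + 1 = j ∨ j + 1 = i) := by
      intro i hi j hj
      have h : G.Adj (v i) (v j) ↔ (SimpleGraph.pathGraph m).Adj _ _ := f.symm.map_adj_iff
      rw [h, SimpleGraph.pathGraph_adj]
      dsimp only
      omega
    have hI : I = (Finset.range m).image v := by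
      ext s
      rw [Finset.mem_image]
      constructor
      · intro hs
        refine ⟨f ⟨s, hs⟩, Finset.mem_range.2 (f ⟨s, hs⟩).2, ?_⟩
        have h : (⟨min (f ⟨s, hs⟩ : ℕ) (m - 1), by omega⟩ : Fin m) = f ⟨s, hs⟩ :=
          Fin.ext (by dsimp only; omega)
        dsimp only [v]
        rw [h, f.symm_apply_apply]
      · rintro ⟨i, -, rfl⟩
        exact Finset.mem_coe.1 (Subtype.property _)
    obtain ⟨hmN, a, ha⟩ := hp.exists_arc_of_path (v := v)
      (by
        intro i j hi hj h
        have := congrArg Fin.val (f.symm.injective (Subtype.ext h))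
        dsimp only at this
        omega)
      (fun i hi => (hv _ (by omega) _ hi).2 (Or.inl rfl))
      (fun i hi h => by have := (hv _ hi _ (by omega)).1 h; omega)
    rw [← hI] at ha
    refine ⟨a, m, ?_, hmN, ha⟩
    rwa [ha, hp.card_arc hmN.le] at hodd
  · rintro ⟨a, k, hodd, hk, rfl⟩
    exact ⟨hp.isTypeA_arc hodd.pos hk, by rwa [hp.card_arc hk.le]⟩

end CycleParam

end Cycle

/-! ### Nested arcs, cut edges and the depth function. -/

section Laminar

variable {S : Type*} [DecidableEq S] {G : SimpleGraph S} {N : ℕ} {p : ℤ → S}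
  {I J : Finset S} {B : Finset (Finset S)} {s t : S}

theorem spade_of_forall_not_adj (hI : I.Nonempty) (hJ : J.Nonempty) (hd : Disjoint I J)
    (h : ∀ s ∈ I, ∀ t ∈ J, ¬ G.Adj s t) : Spade G I J := by
  refine ⟨hd, fun hc => ?_⟩
  obtain ⟨s, hs⟩ := hI
  obtain ⟨t, ht⟩ := hJ
  obtain ⟨w⟩ := hc.preconnected
    ⟨s, by rw [Finset.mem_coe]; exact Finset.mem_union_left _ hs⟩
    ⟨t, by rw [Finset.mem_coe]; exact Finset.mem_union_right _ ht⟩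
  obtain ⟨d, -, h1, h2⟩ := w.exists_boundary_dart {x | (x : S) ∈ I} hs
    (Finset.disjoint_right.1 hd ht)
  exact h _ h1 _ ((Finset.mem_union.1 (Finset.mem_coe.1 d.snd.2)).resolve_left h2) d.adj

namespace CycleParam

theorem connected_of_mem_oddPaths (hp : CycleParam G N p) (hI : I ∈ oddPaths G) :
    (G.induce (I : Set S)).Connected := by
  obtain ⟨a, k, hk, hkN, rfl⟩ := hp.mem_oddPaths_iff.1 hI
  exact hp.connected_arc hk.pos hkN

theorem not_adj_of_spade (hp : CycleParam G N p) (hI : I ∈ oddPaths G) (hJ : J ∈ oddPaths G)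
    (h : Spade G I J) (hs : s ∈ I) (ht : t ∈ J) : ¬ G.Adj s t := by
  intro hadj
  refine h.2 ?_
  rw [Finset.coe_union]
  exact SimpleGraph.connected_induce_union (hp.connected_of_mem_oddPaths hI).preconnected
    (hp.connected_of_mem_oddPaths hJ).preconnected hs ht hadj

/-- `I ≺ J` means that the arc `I` lies in the interior of the arc `J`. -/
theorem exists_interior_of_prec (hp : CycleParam G N p) (hI : I ∈ oddPaths G) {b : ℤ} {m : ℕ}
    (hm : m < N) (h : Prec G I (arc p b m)) :
    ∃ a k, Odd k ∧ I = arc p a k ∧ b < a ∧ a + k < b + m := by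
  obtain ⟨⟨a', k, hk, hkN, rfl⟩, hss, hc⟩ := And.intro (hp.mem_oddPaths_iff.1 hI) h
  have hk0 := hk.pos
  obtain ⟨a, h1, h2, h3, h4⟩ := hp.exists_start (s := p a') b
  rw [h4 a' k rfl] at hss hc ⊢
  have ha : a < b + m := (hp.mem_arc_iff hm.le h1 h2).1
    (hss.1 (mem_arc_of_le le_rfl (by omega)))
  have hak : a + k ≤ b + m := by
    by_contra hlt
    have := (hp.mem_arc_iff hm.le (by omega) (by omega)).1
      (hss.1 (mem_arc_of_le (x := b + m) (a := a) (k := k) (by omega) (by omega)))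
    omega
  have hkm : k < m := by
    have := Finset.card_lt_card hss
    rwa [hp.card_arc hkN.le, hp.card_arc hm.le] at this
  have hsd : ∀ x, b ≤ x → x < b + m →
      (p x ∈ arc p b m \ arc p a k ↔ ¬ (a ≤ x ∧ x < a + k)) := by
    intro x hx1 hx2
    rw [Finset.mem_sdiff, and_iff_right (mem_arc_of_le hx1 hx2), not_iff_not]
    constructor
    · intro hx
      obtain ⟨i, hi, hx⟩ := mem_arc.1 hx
      have := hp.eq_of_lt hx (by omega) (by omega)
      omega
    · exact fun hx => mem_arc_of_le hx.1 hx.2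
  refine ⟨a, k, hk, rfl, lt_of_le_of_ne h1 ?_, lt_of_le_of_ne hak ?_⟩
  -- If the two arcs share an end, their difference is a single arc, hence connected.
  · rintro rfl
    have he : arc p b m \ arc p b k = arc p (b + k) (m - k) := by
      ext s
      constructor
      · intro hs
        obtain ⟨i, hi, rfl⟩ := mem_arc.1 (Finset.mem_sdiff.1 hs).1
        have := (hsd _ (by omega) (by omega)).1 hs
        exact mem_arc_of_le (by omega) (by omega)
      · intro hs
        obtain ⟨i, hi, rfl⟩ := mem_arc.1 hs
        exact (hsd _ (by omega) (by omega)).2 (by omega)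
    rw [he] at hc
    exact hc (hp.connected_arc (by omega) (by omega))
  · intro hab
    have he : arc p b m \ arc p a k = arc p b (m - k) := by
      ext s
      constructor
      · intro hs
        obtain ⟨i, hi, rfl⟩ := mem_arc.1 (Finset.mem_sdiff.1 hs).1
        have := (hsd _ (by omega) (by omega)).1 hs
        exact mem_arc_of_le (by omega) (by omega)
      · intro hs
        obtain ⟨i, hi, rfl⟩ := mem_arc.1 hs
        exact (hsd _ (by omega) (by omega)).2 (by omega)
    rw [he] at hc
    exact hc (hp.connected_arc (by omega) (by omega))

theorem mem_of_prec_of_adj (hp : CycleParam G N p) (hI : I ∈ oddPaths G) (hJ : J ∈ oddPaths G)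
    (h : Prec G I J) (hs : s ∈ I) (hadj : G.Adj s t) : t ∈ J := by
  obtain ⟨b, m, hm, hmN, rfl⟩ := hp.mem_oddPaths_iff.1 hJ
  obtain ⟨a, k, -, rfl, h1, h2⟩ := hp.exists_interior_of_prec hI hmN h
  obtain ⟨i, hi, rfl⟩ := mem_arc.1 hs
  rcases hp.eq_or_eq_of_adj hadj with rfl | rfl <;> exact mem_arc_of_le (by omega) (by omega)

/-- Deleting the vertex of odd index `i` leaves arcs of lengths `i` and `k - i - 1`, both odd. -/
theorem mem_evPart (hp : CycleParam G N p) {a : ℤ} {k i : ℕ} (hk : Odd k) (hkN : k < N)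
    (hi : Odd i) (hik : i < k) : p (a + i) ∈ evPart G (arc p a k) := by
  have hi0 := hi.pos
  have hodd : Odd (k - i - 1) := by
    obtain ⟨x, rfl⟩ := hk
    obtain ⟨y, rfl⟩ := hi
    exact ⟨x - y - 1, by omega⟩
  have ho := hodd.pos
  have hdis : ∀ u ∈ arc p a i, ∀ v ∈ arc p (a + i + 1) (k - i - 1), u ≠ v ∧ ¬ G.Adj u v := by
    intro u hu v hv
    obtain ⟨x, hx, rfl⟩ := mem_arc.1 hu
    obtain ⟨y, hy, rfl⟩ := mem_arc.1 hv
    refine ⟨fun h => ?_, fun h => ?_⟩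
    · have := hp.eq_of_lt h (by omega) (by omega)
      omega
    · have hodd' := hp.odd
      rcases (hp.adj_iff _ _).1 h with h | h
      · have := hp.eq_of_lt h (by omega) (by omega)
        omega
      -- As `k` and `N` are both odd, at least two vertices lie outside the arc, so its ends are not
      -- adjacent round the back.
      · have hkN2 : k + 1 < N := by
          rcases hk with ⟨z, rfl⟩
          rcases hodd' with ⟨w, rfl⟩
          omega
        have := hp.eq_of_lt h (by omega) (by omega)
        omega
  refine ⟨mem_arc_of_le (by omega) (by omega), arc p a i,
    hp.mem_oddPaths_iff.2 ⟨_, _, hi, by omega, rfl⟩, arc p (a + i + 1) (k - i - 1),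
    hp.mem_oddPaths_iff.2 ⟨_, _, hodd, by omega, rfl⟩, spade_of_forall_not_adj
      ⟨_, mem_arc_of_le (x := a) le_rfl (by omega)⟩
      ⟨_, mem_arc_of_le (x := a + i + 1) le_rfl (by omega)⟩
      (Finset.disjoint_left.2 fun u hu hv => (hdis u hu u hv).1 rfl)
      fun u hu v hv => (hdis u hu v hv).2, ?_⟩
  ext s
  rw [Finset.mem_erase, Finset.mem_union]
  constructor
  · rintro ⟨hne, hs⟩
    obtain ⟨x, hx, rfl⟩ := mem_arc.1 hs
    rcases lt_trichotomy x i with h | h | h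
    · exact Or.inl (mem_arc_of_le (by omega) (by omega))
    · exact absurd (by rw [h]) hne
    · exact Or.inr (mem_arc_of_le (by omega) (by omega))
  · rintro (hs | hs) <;> obtain ⟨x, hx, rfl⟩ := mem_arc.1 hs <;>
      refine ⟨fun h => ?_, mem_arc_of_le (by omega) (by omega)⟩ <;>
      have := hp.eq_of_lt h (by omega) (by omega) <;> omega

theorem trichotomy (hp : CycleParam G N p) (hB : B ∈ phi G) (hI : I ∈ B) (hJ : J ∈ B)
    (h : (∃ s ∈ I, s ∈ J) ∨ ∃ s ∈ I, ∃ t ∈ J, G.Adj s t) :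
    I = J ∨ Prec G I J ∨ Prec G J I := by
  rcases hB.2.1 I hI J hJ with h' | h' | h'
  · exact Or.inl h'
  · exfalso
    rcases h with ⟨s, hs, ht⟩ | ⟨s, hs, t, ht, hadj⟩
    · exact Finset.disjoint_left.1 h'.1 hs ht
    · exact hp.not_adj_of_spade (hB.1 I hI) (hB.1 J hJ) h' hs ht hadj
  · exact Or.inr h'

/-- Every edge that meets a member of `B` is cut by some member of `B`. -/
theorem exists_cut (hp : CycleParam G N p) (hB : B ∈ phi G) (hadj : G.Adj s t) (hI : I ∈ B)
    (hs : s ∈ I ∨ t ∈ I) : ∃ J ∈ B, ¬ (s ∈ J ↔ t ∈ J) := by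
  induction hn : I.card using Nat.strong_induction_on generalizing I with
  | h n ih =>
    by_cases hcut : s ∈ I ↔ t ∈ I
    swap
    · exact ⟨I, hI, hcut⟩
    have key : ∀ i : ℕ, ∀ a k, I = arc p a k → Odd k → k < N → i + 1 < k →
        ((s = p (a + i) ∧ t = p (a + i + 1)) ∨ (t = p (a + i) ∧ s = p (a + i + 1))) →
        ∃ J ∈ B, J.card < I.card ∧ (s ∈ J ∨ t ∈ J) := by
      intro i a k hIa hk hkN hi hst
      -- One of two consecutive indices is odd; (P₁) then provides a smaller member meeting the
      -- edge, and the induction descends to it.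
      have hev : s ∈ evPart G I ∨ t ∈ evPart G I := by
        subst hIa
        rcases Nat.even_or_odd i with he | ho
        · have h1 := hp.mem_evPart (a := a) hk hkN (Even.add_one he) hi
          push_cast at h1
          rw [← add_assoc] at h1
          rcases hst with h | h
          · exact Or.inr (by rwa [h.2])
          · exact Or.inl (by rwa [h.2])
        · have h1 := hp.mem_evPart (a := a) hk hkN ho (by omega)
          rcases hst with h | h
          · exact Or.inl (by rwa [h.1])
          · exact Or.inr (by rwa [h.1])
      obtain ⟨C, hCB, hC, -, hcov⟩ := hB.2.2 I hI
      rcases hev with h | h <;> obtain ⟨J, hJ, hmem⟩ := Set.mem_iUnion₂.1 (hcov h)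
      · exact ⟨J, hCB hJ, Finset.card_lt_card (hC J hJ).1, Or.inl hmem⟩
      · exact ⟨J, hCB hJ, Finset.card_lt_card (hC J hJ).1, Or.inr hmem⟩
    have hsI : s ∈ I := by tauto
    have htI : t ∈ I := by tauto
    obtain ⟨a, k, hk, hkN, hIa⟩ := hp.mem_oddPaths_iff.1 (hB.1 I hI)
    have hsI' := hsI
    rw [hIa, mem_arc] at hsI'
    obtain ⟨i, hi, rfl⟩ := hsI'
    have hJ : ∃ J ∈ B, J.card < I.card ∧ (p (a + i) ∈ J ∨ t ∈ J) := by
      rcases hp.eq_or_eq_of_adj hadj with rfl | rfl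
      · refine key i a k hIa hk hkN ?_ (Or.inl ⟨rfl, rfl⟩)
        rw [hIa, hp.mem_arc_iff hkN.le (by omega) (by omega)] at htI
        omega
      · rcases Nat.eq_zero_or_pos i with rfl | hpos
        · exfalso
          rw [hIa, mem_arc] at htI
          obtain ⟨j, hj, h⟩ := htI
          have hkN2 : k + 1 < N := by
            rcases hk with ⟨z, rfl⟩
            rcases hp.odd with ⟨w, rfl⟩
            omega
          have := hp.eq_of_lt h (by omega) (by omega)
          omega
        · obtain ⟨j, rfl⟩ := Nat.exists_eq_add_of_le' hpos
          refine key j a k hIa hk hkN hi (Or.inr ⟨?_, ?_⟩) <;> congr 1 <;> push_cast <;> ring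
    obtain ⟨J, hJB, hlt, hmem⟩ := hJ
    exact ih _ (hn ▸ hlt) hJB hmem rfl

/-- Every edge is cut by at most one member of `B`. -/
theorem cut_unique (hp : CycleParam G N p) (hB : B ∈ phi G) (hadj : G.Adj s t) (hI : I ∈ B)
    (hJ : J ∈ B) (hcI : ¬ (s ∈ I ↔ t ∈ I)) (hcJ : ¬ (s ∈ J ↔ t ∈ J)) : I = J := by
  have hmeet : (∃ s ∈ I, s ∈ J) ∨ ∃ s ∈ I, ∃ t ∈ J, G.Adj s t := by
    by_cases h1 : s ∈ I <;> by_cases h2 : s ∈ J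
    · exact Or.inl ⟨s, h1, h2⟩
    · exact Or.inr ⟨s, h1, t, by_contra fun ht => hcJ (iff_of_false h2 ht), hadj⟩
    · exact Or.inr ⟨t, by_contra fun ht => hcI (iff_of_false h1 ht), s, h2, hadj.symm⟩
    · exact Or.inl ⟨t, by_contra fun ht => hcI (iff_of_false h1 ht),
        by_contra fun ht => hcJ (iff_of_false h2 ht)⟩
  -- A smaller arc is interior to the larger, so the larger contains both ends of any edge cut by
  -- the smaller.
  have aux : ∀ {I J}, I ∈ B → J ∈ B → ¬ (s ∈ I ↔ t ∈ I) → ¬ (s ∈ J ↔ t ∈ J) → ¬ Prec G I J := by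
    intro I J hI hJ hcI hcJ h
    by_cases hs : s ∈ I
    · exact hcJ (iff_of_true (h.1.1 hs) (hp.mem_of_prec_of_adj (hB.1 I hI) (hB.1 J hJ) h hs hadj))
    · have ht : t ∈ I := by_contra fun ht => hcI (iff_of_false hs ht)
      exact hcJ (iff_of_true
        (hp.mem_of_prec_of_adj (hB.1 I hI) (hB.1 J hJ) h ht hadj.symm) (h.1.1 ht))
  exact (hp.trichotomy hB hI hJ hmeet).resolve_right
    (not_or.2 ⟨aux hI hJ hcI hcJ, aux hJ hI hcJ hcI⟩)

theorem gCount_eq_add_one (hp : CycleParam G N p) (hB : B ∈ phi G) (hadj : G.Adj s t)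
    (hI : I ∈ B) (hs : s ∉ I) (ht : t ∈ I) : gCount B t = gCount B s + 1 := by
  -- By uniqueness of the cut, every member other than `I` contains both ends of the edge or
  -- neither.
  have h : B.filter (fun J => t ∈ J) = insert I (B.filter fun J => s ∈ J) := by
    ext J
    rw [Finset.mem_insert, Finset.mem_filter, Finset.mem_filter]
    constructor
    · rintro ⟨hJ, htJ⟩
      by_cases hsJ : s ∈ J
      · exact Or.inr ⟨hJ, hsJ⟩
      · exact Or.inl (hp.cut_unique hB hadj hJ hI (by tauto) (by tauto))
    · rintro (rfl | ⟨hJ, hsJ⟩)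
      · exact ⟨hI, ht⟩
      · refine ⟨hJ, ?_⟩
        by_contra htJ
        exact hs (hp.cut_unique hB hadj hJ hI (by tauto) (by tauto) ▸ hsJ)
  rw [gCount, h, Finset.card_insert_of_notMem, gCount]
  simp [hs]

theorem gCount_adj (hp : CycleParam G N p) (hB : B ∈ phi G) (hadj : G.Adj s t) :
    gCount B t = gCount B s + 1 ∨ gCount B s = gCount B t + 1 ∨
      (gCount B s = 0 ∧ gCount B t = 0) := by
  by_cases h : ∃ I ∈ B, s ∈ I ∨ t ∈ I
  · obtain ⟨I, hI, hst⟩ := h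
    obtain ⟨J, hJ, hcut⟩ := hp.exists_cut hB hadj hI hst
    by_cases hs : s ∈ J
    · exact Or.inr (Or.inl (hp.gCount_eq_add_one hB hadj.symm hJ (by tauto) hs))
    · exact Or.inl (hp.gCount_eq_add_one hB hadj hJ hs (by tauto))
  · push Not at h
    refine Or.inr (Or.inr ⟨?_, ?_⟩) <;> rw [gCount, Finset.card_eq_zero,
      Finset.filter_eq_empty_iff]
    · exact fun J hJ => (h J hJ).1
    · exact fun J hJ => (h J hJ).2

end CycleParam

end Laminar

/-! ### Comparison of depth functions through triangular numbers modulo 2. -/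

section Depth

/-- The triangular number `n (n + 1) / 2` modulo `2`. -/
def tri (n : ℕ) : ZMod 2 :=
  ((n * (n + 1) / 2 : ℕ) : ZMod 2)

theorem tri_succ (n : ℕ) : tri (n + 1) = tri n + ((n + 1 : ℕ) : ZMod 2) := by
  have h : (n + 1) * (n + 1 + 1) / 2 = n * (n + 1) / 2 + (n + 1) := by
    rw [← Nat.add_mul_div_right _ _ (by norm_num : 0 < 2)]
    congr 1
    ring
  rw [tri, h, Nat.cast_add, tri]

theorem tri_succ_eq_iff (n : ℕ) : tri (n + 1) = tri n ↔ n % 2 = 1 := by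
  rw [tri_succ, add_eq_left, ZMod.natCast_eq_zero_iff]
  omega

/-- Consecutive depths: they differ by `1` or are both `0`. -/
def DepthAdj (m n : ℕ) : Prop :=
  n = m + 1 ∨ m = n + 1 ∨ (m = 0 ∧ n = 0)

/-- For `m > 0` the candidates are m - 1 and m + 1, whose triangular numbers differ by the odd
number 2m + 1; for `m = 0` they are 0 and 1. -/
theorem DepthAdj.eq_of_tri_eq {m u v : ℕ} (hu : DepthAdj m u) (hv : DepthAdj m v)
    (h : tri u = tri v) : u = v := by
  have key : ∀ n, tri (n + 1 + 1) ≠ tri n := by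
    intro n hn
    rw [tri_succ, tri_succ, add_assoc, add_eq_left, ← Nat.cast_add, ZMod.natCast_eq_zero_iff] at hn
    omega
  have h01 : tri (0 + 1) ≠ tri 0 := by
    rw [Ne, tri_succ_eq_iff]
    omega
  rcases hu with rfl | rfl | ⟨rfl, rfl⟩ <;> rcases hv with hv | hv | ⟨hv, rfl⟩
  · exact hv.symm
  · subst hv
    exact absurd h (key v)
  · subst hv
    exact absurd h h01
  · subst hv
    exact absurd h.symm (key u)
  · omega
  · omega
  · subst hv
    exact absurd h.symm h01
  · omega
  · rfl

variable {S : Type*} [DecidableEq S] {G : SimpleGraph S} {N : ℕ} {p : ℤ → S}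
  {I J : Finset S} {B B' : Finset (Finset S)} {s t : S}

namespace CycleParam

theorem depthAdj (hp : CycleParam G N p) (hB : B ∈ phi G) (hadj : G.Adj s t) :
    DepthAdj (gCount B s) (gCount B t) :=
  hp.gCount_adj hB hadj

theorem notMem_arc_end (hp : CycleParam G N p) {a : ℤ} {k : ℕ} (hk : k < N) :
    p (a + k) ∉ arc p a k := by
  rw [hp.mem_arc_iff hk.le (by omega) (by omega)]
  omega

theorem notMem_arc_pred (hp : CycleParam G N p) {a : ℤ} {k : ℕ} (hk : k < N) :
    p (a - 1) ∉ arc p a k := by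
  rw [← hp.add_period, hp.mem_arc_iff hk.le (by omega) (by omega)]
  omega

theorem exists_eq_arc (hp : CycleParam G N p) (hB : B ∈ phi G) (hI : I ∈ B) :
    ∃ a k, Odd k ∧ k < N ∧ I = arc p a k :=
  hp.mem_oddPaths_iff.1 (hB.1 I hI)

/-- The two vertices next to the ends of a member of `B` lie in the same members of `B`. -/
theorem outer_mem_iff (hp : CycleParam G N p) (hB : B ∈ phi G) {b : ℤ} {m : ℕ} (hm : 0 < m)
    (hmN : m < N) (hI : arc p b m ∈ B) (hJ : J ∈ B) : p (b - 1) ∈ J ↔ p (b + m) ∈ J := by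
  have hpred := hp.notMem_arc_pred (a := b) hmN
  have hend := hp.notMem_arc_end (a := b) hmN
  have hfst : p b ∈ arc p b m := mem_arc_of_le le_rfl (by omega)
  have hlst : p (b + m - 1) ∈ arc p b m := mem_arc_of_le (by omega) (by omega)
  have hadj := hp.adj_pred b
  have hadj' := hp.adj_pred (b + m)
  have aux : ∀ u ∈ arc p b m, u ∈ J → (p (b - 1) ∈ J ∨ p (b + m) ∈ J) →
      Prec G (arc p b m) J := by
    intro u hu huJ hout
    rcases hp.trichotomy hB hI hJ (Or.inl ⟨u, hu, huJ⟩) with h | h | h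
    · subst h
      tauto
    · exact h
    · have := @h.1.1 (p (b - 1))
      have := @h.1.1 (p (b + m))
      tauto
  constructor
  · intro h
    -- Otherwise `J` cuts the edge at the start of the arc and so equals the arc, which omits `p (b
    -- - 1)`.
    have hb : p b ∈ J := by
      by_contra hb
      rw [← hp.cut_unique hB hadj hI hJ (by tauto) (by tauto)] at h
      exact hpred h
    exact hp.mem_of_prec_of_adj (hB.1 _ hI) (hB.1 J hJ) (aux _ hfst hb (Or.inl h)) hlst hadj'
  · intro h
    have hb : p (b + m - 1) ∈ J := by
      by_contra hb
      rw [← hp.cut_unique hB hadj' hI hJ (by tauto) (by tauto)] at h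
      exact hend h
    exact hp.mem_of_prec_of_adj (hB.1 _ hI) (hB.1 J hJ) (aux _ hlst hb (Or.inr h)) hfst hadj.symm

theorem gCount_start (hp : CycleParam G N p) (hB : B ∈ phi G) {a : ℤ} {k : ℕ} (hk : 0 < k)
    (hkN : k < N) (hI : arc p a k ∈ B) : gCount B (p a) = gCount B (p (a - 1)) + 1 :=
  hp.gCount_eq_add_one hB (hp.adj_pred a) hI (hp.notMem_arc_pred hkN)
    (mem_arc_of_le le_rfl (by omega))

theorem gCount_end_lt (hp : CycleParam G N p) (hB : B ∈ phi G) {a : ℤ} {k : ℕ} (hk : 0 < k)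
    (hkN : k < N) (hI : arc p a k ∈ B) : gCount B (p (a + k)) < gCount B (p a) := by
  have h : gCount B (p (a - 1)) = gCount B (p (a + k)) := by
    unfold gCount
    congr 1
    exact Finset.filter_congr fun J hJ => hp.outer_mem_iff hB hk hkN hI hJ
  rw [hp.gCount_start hB hk hkN hI, h]
  omega

theorem gCount_start_le (hp : CycleParam G N p) (hB : B ∈ phi G) {a : ℤ} {k : ℕ} (hk : 0 < k)
    (hkN : k < N) (hI : arc p a k ∈ B) (hs : s ∈ arc p a k) : gCount B (p a) ≤ gCount B s := by
  refine Finset.card_le_card fun J hJ => ?_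
  rw [Finset.mem_filter] at hJ ⊢
  refine ⟨hJ.1, ?_⟩
  have hfst : p a ∈ arc p a k := mem_arc_of_le le_rfl (by omega)
  rcases hp.trichotomy hB hI hJ.1 (Or.inl ⟨_, hfst, hJ.2⟩) with h | h | h
  · exact h ▸ hs
  · exact h.1.1 hs
  · exact absurd (hp.mem_of_prec_of_adj (hB.1 J hJ.1) (hB.1 _ hI) h hJ.2 (hp.adj_pred a).symm)
      (hp.notMem_arc_pred hkN)

/-- A member of `φ` is determined by its depth function. -/
theorem subset_of_gCount_eq (hp : CycleParam G N p) (hB : B ∈ phi G) (hB' : B' ∈ phi G)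
    (h : ∀ s, gCount B s = gCount B' s) : B ⊆ B' := by
  intro I hI
  obtain ⟨a, k, hk, hkN, rfl⟩ := hp.exists_eq_arc hB hI
  have h1 := hp.gCount_start hB hk.pos hkN hI
  rw [h, h] at h1
  obtain ⟨J, hJ⟩ := Finset.card_pos.1 (show 0 < gCount B' (p a) by omega)
  rw [Finset.mem_filter] at hJ
  obtain ⟨K, hK, hcut⟩ := hp.exists_cut hB' (hp.adj_pred a) hJ.1 (Or.inr hJ.2)
  -- The depth rises from `p (a - 1)` to `p a`, so the member cutting this edge contains `p a` and
  -- starts there.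
  have haK : p a ∈ K := by
    by_contra haK
    have := hp.gCount_eq_add_one hB' (hp.adj_pred a).symm hK haK (by tauto)
    omega
  obtain ⟨a', k', hk', hkN', rfl⟩ := hp.exists_eq_arc hB' hK
  obtain ⟨b, hb, hb1, hb2⟩ := hp.exists_arc_through haK
  rw [hb] at hcut hK haK
  have hba : b = a := by
    by_contra hne
    exact hcut (iff_of_true (mem_arc_of_le (by omega) (by omega)) haK)
  subst hba
  -- The depth stays at least its starting value on the arc and drops below it just past the end, so
  -- the common depth function fixes the length.
  rcases lt_trichotomy k k' with hlt | rfl | hlt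
  · have h2 := hp.gCount_end_lt hB hk.pos hkN hI
    have h3 := hp.gCount_start_le hB' hk'.pos hkN' hK
      (mem_arc_of_le (x := b + k) (by omega) (by omega))
    rw [h, h] at h2
    omega
  · exact hK
  · have h2 := hp.gCount_end_lt hB' hk'.pos hkN' hK
    have h3 := hp.gCount_start_le hB hk.pos hkN hI
      (mem_arc_of_le (x := b + k') (by omega) (by omega))
    rw [h, h] at h3
    omega

variable {f : Finset S → ZMod 2} {c : ZMod 2}

theorem tri_gCount_cut (hp : CycleParam G N p) (hB : B ∈ phi G)
    (hT : ∀ s, tri (gCount B' s) = c + ∑ I ∈ B, if s ∈ I then f I else 0)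
    (hadj : G.Adj s t) (hI : I ∈ B) (hs : s ∉ I) (ht : t ∈ I) :
    tri (gCount B' t) = tri (gCount B' s) + f I := by
  rw [hT, hT, ← Finset.add_sum_erase B _ hI, ← Finset.add_sum_erase B _ hI, if_pos ht, if_neg hs,
    zero_add, add_assoc, add_comm (f I)]
  congr 2
  refine Finset.sum_congr rfl fun J hJ => ?_
  rw [Finset.mem_erase] at hJ
  have h : s ∈ J ↔ t ∈ J := by
    by_contra h
    exact hJ.1 (hp.cut_unique hB hadj hJ.2 hI h (by tauto))
  simp only [h]

/-- Walk left from a vertex of the arc lying in no smaller member: the edge before it is cut by a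
smaller member ending there. By `hA` that member can be jumped over without changing the depth of
`B'`, and the landing point again lies in no smaller member. -/
theorem gCount_eq_start_of_forall (hp : CycleParam G N p) (hB : B ∈ phi G) {a : ℤ} {k : ℕ}
    (hkN : k < N) (hI : arc p a k ∈ B)
    (hA : ∀ (m : ℕ) (b : ℤ), m < k → 0 < m → arc p b m ∈ B →
      gCount B' (p (b - 1)) = gCount B' (p (b + m)))
    {i : ℕ} (hi : i < k) (hmin : ∀ J ∈ B, p (a + i) ∈ J → ¬ Prec G J (arc p a k)) :
    gCount B' (p (a + i)) = gCount B' (p a) := by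
  induction i using Nat.strong_induction_on with
  | h i ih =>
    rcases Nat.eq_zero_or_pos i with rfl | hi0
    · simp
    have h1 : p (a + i - 1) ∈ arc p a k := mem_arc_of_le (by omega) (by omega)
    have h2 : p (a + i) ∈ arc p a k := mem_arc_of_le (by omega) (by omega)
    obtain ⟨J, hJ, hcut⟩ := hp.exists_cut hB (hp.adj_pred (a + i)) hI (Or.inl h1)
    have hJI : Prec G J (arc p a k) := by
      have hmeet : ∃ s ∈ arc p a k, s ∈ J := by
        by_cases h : p (a + i) ∈ J
        · exact ⟨_, h2, h⟩
        · exact ⟨_, h1, by tauto⟩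
      rcases hp.trichotomy hB hI hJ (Or.inl hmeet) with h | h | h
      · exact absurd (iff_of_true (h ▸ h1) (h ▸ h2)) hcut
      · exact absurd (iff_of_true (h.1.1 h1) (h.1.1 h2)) hcut
      · exact h
    have hiJ : p (a + i) ∉ J := fun h => hmin J hJ h hJI
    have hiJ' : p (a + i - 1) ∈ J := by tauto
    obtain ⟨b, m, hm, rfl, hb1, hb2⟩ := hp.exists_interior_of_prec (hB.1 J hJ) hkN hJI
    have hm0 := hm.pos
    obtain ⟨j, hj, hji⟩ := mem_arc.1 hiJ'
    have hji' := hp.eq_of_lt hji (by omega) (by omega)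
    have hend : b + m = a + i := by
      by_contra hne
      exact hiJ (mem_arc_of_le (by omega) (by omega))
    obtain ⟨i', hi'⟩ := Int.eq_ofNat_of_zero_le (show 0 ≤ b - 1 - a by omega)
    have hb : b - 1 = a + i' := by omega
    rw [← hend, ← hA m b (by omega) hm0 hJ, hb]
    refine ih i' (by omega) (by omega) fun K hK hKm => hmin K hK ?_
    rwa [← hb, hp.outer_mem_iff hB hm0 (by omega) hJ hK, hend] at hKm

/-- By induction on length, the depth of `B'` agrees at the first and last vertices of the arc.
Leaving through either end changes `tri` by the same `f I`, so the two outside depths are neighbours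
of one value with equal `tri`, hence equal. -/
theorem gCount_pred_eq_end (hp : CycleParam G N p) (hB : B ∈ phi G) (hB' : B' ∈ phi G)
    (hT : ∀ s, tri (gCount B' s) = c + ∑ I ∈ B, if s ∈ I then f I else 0)
    (k : ℕ) (a : ℤ) (hkN : k < N) (hk : 0 < k) (hI : arc p a k ∈ B) :
    gCount B' (p (a - 1)) = gCount B' (p (a + k)) := by
  induction k using Nat.strong_induction_on generalizing a with
  | h k ih =>
    have hpred := hp.notMem_arc_pred (a := a) hkN
    have hend := hp.notMem_arc_end (a := a) hkN
    have hfst : p a ∈ arc p a k := mem_arc_of_le le_rfl (by omega)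
    have hlst : p (a + k - 1) ∈ arc p a k := mem_arc_of_le (by omega) (by omega)
    have hadj := hp.adj_pred a
    have hadj' := hp.adj_pred (a + k)
    have heq : gCount B' (p (a + k - 1)) = gCount B' (p a) := by
      have hidx : a + k - 1 = a + (k - 1 : ℕ) := by omega
      rw [hidx]
      refine hp.gCount_eq_start_of_forall hB hkN hI
        (fun m b hm hm0 h => ih m hm b (by omega) hm0 h) (by omega) fun J hJ hmem h => ?_
      rw [← hidx] at hmem
      exact hend (hp.mem_of_prec_of_adj (hB.1 J hJ) (hB.1 _ hI) h hmem hadj')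
    have h1 := hp.tri_gCount_cut hB hT hadj hI hpred hfst
    have h2 := hp.tri_gCount_cut hB hT hadj'.symm hI hend hlst
    rw [heq, h1] at h2
    have h3 := hp.depthAdj hB' hadj.symm
    have h4 := hp.depthAdj hB' hadj'
    rw [heq] at h4
    exact h3.eq_of_tri_eq h4 (add_right_cancel h2)

theorem gCount_eq_start (hp : CycleParam G N p) (hB : B ∈ phi G) (hB' : B' ∈ phi G)
    (hT : ∀ s, tri (gCount B' s) = c + ∑ I ∈ B, if s ∈ I then f I else 0)
    {a : ℤ} {k : ℕ} (hkN : k < N) (hI : arc p a k ∈ B) (hs : s ∈ arc p a k)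
    (hmin : ∀ J ∈ B, s ∈ J → ¬ Prec G J (arc p a k)) :
    gCount B' s = gCount B' (p a) := by
  obtain ⟨i, hi, rfl⟩ := mem_arc.1 hs
  exact hp.gCount_eq_start_of_forall hB hkN hI
    (fun m b hm hm0 h => hp.gCount_pred_eq_end hB hB' hT m b (by omega) hm0 h) hi hmin

theorem notMem_of_gCount_eq_zero (h : gCount B s = 0) (hI : I ∈ B) : s ∉ I := by
  rw [gCount, Finset.card_eq_zero, Finset.filter_eq_empty_iff] at h
  exact h hI

theorem tri_gCount_of_eq_zero
    (hT : ∀ s, tri (gCount B' s) = c + ∑ I ∈ B, if s ∈ I then f I else 0)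
    (hs : gCount B s = 0) : tri (gCount B' s) = c := by
  rw [hT, Finset.sum_eq_zero, add_zero]
  exact fun I hI => if_neg (notMem_of_gCount_eq_zero hs hI)

/-- Walk through the vertices outside the support of `B`, where `tri (gCount B' ·)` equals `c`. A
single step stays at 0 or joins an odd depth to its successor, so it never passes between zero and
nonzero and flips parity when nonzero. A jump over an arc of odd length `m` advances `m + 1` places,
an even number, and preserves the depth. -/
theorem gCount_parity (hp : CycleParam G N p) (hB : B ∈ phi G) (hB' : B' ∈ phi G)
    (hT : ∀ s, tri (gCount B' s) = c + ∑ I ∈ B, if s ∈ I then f I else 0)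
    {x : ℤ} (hx : gCount B (p x) = 0) (n : ℕ) (hn : gCount B (p (x + n)) = 0) :
    (gCount B' (p x) = 0 ∧ gCount B' (p (x + n)) = 0) ∨
      (gCount B' (p (x + n)) ≠ 0 ∧ (gCount B' (p x) + gCount B' (p (x + n)) + n) % 2 = 0) := by
  induction n using Nat.strong_induction_on with
  | h n ih =>
    rcases Nat.eq_zero_or_pos n with rfl | hn0
    · simp only [Nat.cast_zero, add_zero]
      omega
    have hadj := hp.adj_pred (x + n)
    by_cases hz : gCount B (p (x + n - 1)) = 0
    · have hidx : x + n - 1 = x + (n - 1 : ℕ) := by omega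
      have hd := hp.depthAdj hB' hadj
      have htri := (tri_gCount_of_eq_zero hT hz).trans (tri_gCount_of_eq_zero hT hn).symm
      rw [hidx] at hz hd htri
      have h := ih (n - 1) (by omega) hz
      rcases hd with hd | hd | hd
      · rw [hd, eq_comm, tri_succ_eq_iff] at htri
        omega
      · rw [hd, tri_succ_eq_iff] at htri
        omega
      · omega
    · obtain ⟨I, hI⟩ := Finset.card_pos.1 (Nat.pos_of_ne_zero hz)
      rw [Finset.mem_filter] at hI
      obtain ⟨J, hJ, hcut⟩ := hp.exists_cut hB hadj hI.1 (Or.inl hI.2)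
      have hnJ := notMem_of_gCount_eq_zero hn hJ
      have hJ' : p (x + n - 1) ∈ J := by tauto
      have hxJ := notMem_of_gCount_eq_zero hx hJ
      obtain ⟨a, m, hm, hmN, rfl⟩ := hp.exists_eq_arc hB hJ
      obtain ⟨b, hb, hb1, hb2⟩ := hp.exists_arc_through hJ'
      rw [hb] at hJ hxJ hnJ
      have hend : b + m = x + n := by
        by_contra hne
        exact hnJ (mem_arc_of_le (by omega) (by omega))
      have hbx : x < b := by
        by_contra hne
        exact hxJ (mem_arc_of_le (by omega) (by omega))
      obtain ⟨i, hi⟩ := Int.eq_ofNat_of_zero_le (show 0 ≤ b - 1 - x by omega)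
      have hbi : b - 1 = x + i := by omega
      have hA := hp.gCount_pred_eq_end hB hB' hT m b hmN hm.pos hJ
      have hz' : gCount B (p (b - 1)) = 0 := by
        rw [gCount, Finset.card_eq_zero, Finset.filter_eq_empty_iff]
        intro K hK
        rw [hp.outer_mem_iff hB hm.pos hmN hJ hK, hend]
        exact notMem_of_gCount_eq_zero hn hK
      rw [hend, hbi] at hA
      rw [hbi] at hz'
      have h := ih i (by omega) hz'
      rw [hA] at h
      obtain ⟨r, hr⟩ := hm
      omega

theorem gCount_eq_zero (hp : CycleParam G N p) (hB : B ∈ phi G) (hB' : B' ∈ phi G)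
    (hT : ∀ s, tri (gCount B' s) = c + ∑ I ∈ B, if s ∈ I then f I else 0)
    (hs : gCount B s = 0) : gCount B' s = 0 := by
  obtain ⟨x, rfl⟩ := hp.surj s
  -- After a full turn the nonzero alternative would make twice a depth plus the odd number `N`
  -- even.
  have h := hp.gCount_parity hB hB' hT hs N (by rwa [hp.add_period])
  rw [hp.add_period] at h
  obtain ⟨r, hr⟩ := hp.odd
  omega

/-- If `ε(B') ∈ ⟨B⟩` then the depth function of `B'` is at most that of `B`. -/
theorem gCount_le (hp : CycleParam G N p) (hB : B ∈ phi G) (hB' : B' ∈ phi G)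
    (hT : ∀ s, tri (gCount B' s) = c + ∑ I ∈ B, if s ∈ I then f I else 0) (s : S) :
    gCount B' s ≤ gCount B s := by
  induction hn : gCount B s using Nat.strong_induction_on generalizing s with
  | h n ih =>
    rcases Nat.eq_zero_or_pos n with rfl | hn0
    · exact (hp.gCount_eq_zero hB hB' hT hn).le
    -- In the smallest member through `s` the depth of `B'` at `s` is the one at its start, at most
    -- 1 above that of the preceding vertex, where the induction applies.
    obtain ⟨I, hI, hmin⟩ := Finset.exists_min_image _ Finset.card (Finset.card_pos.1 (hn ▸ hn0))
    simp only [Finset.mem_filter] at hI hmin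
    obtain ⟨a, k, hk, hkN, rfl⟩ := hp.exists_eq_arc hB hI.1
    have h1 := hp.gCount_eq_start hB hB' hT hkN hI.1 hI.2 fun J hJ hsJ h =>
      absurd (hmin J ⟨hJ, hsJ⟩) (not_le.2 (Finset.card_lt_card h.1))
    have h2 := hp.gCount_start hB hk.pos hkN hI.1
    have h3 := hp.gCount_start_le hB hk.pos hkN hI.1 hI.2
    have h4 := ih _ (by omega) (p (a - 1)) rfl
    rcases hp.depthAdj hB' (hp.adj_pred a) with h | h | h <;> omega

end CycleParam

end Depth

/-! ### Removing the member that cuts a fixed edge. -/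

section Bang

variable {S : Type*} [DecidableEq S] {G : SimpleGraph S} {N : ℕ} {p : ℤ → S}
  {I J : Finset S} {B B' : Finset (Finset S)} {s t : S}

theorem card_inter_pair_eq_one_iff (hst : s ≠ t) :
    (I ∩ {s, t}).card = 1 ↔ ¬ (s ∈ I ↔ t ∈ I) := by
  by_cases hs : s ∈ I <;> by_cases ht : t ∈ I <;>
    simp [hs, ht, hst, Finset.inter_insert_of_mem, Finset.inter_insert_of_notMem,
      Finset.inter_singleton_of_mem, Finset.inter_singleton_of_notMem]

/-- A removed member contains only one end of the edge, so it was not counted. -/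
theorem nCount_bang (hst : s ≠ t) (B : Finset (Finset S)) :
    nCount {s, t} (bang {s, t} B) = nCount {s, t} B := by
  unfold bang
  split_ifs
  · unfold nCount
    congr 1
    ext I
    simp only [Finset.mem_filter, Finset.mem_sdiff, card_inter_pair_eq_one_iff hst,
      Finset.insert_subset_iff, Finset.singleton_subset_iff]
    tauto
  · rfl

theorem bang_subset (ed : Finset S) (B : Finset (Finset S)) : bang ed B ⊆ B := by
  unfold bang
  split_ifs
  · exact Finset.sdiff_subset
  · exact subset_rfl

namespace CycleParam

theorem existsUnique_cut (hp : CycleParam G N p) (hB : B ∈ phi G) (hadj : G.Adj s t)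
    (hI : I ∈ B) (h : s ∈ I ∨ t ∈ I) : ∃! J, J ∈ B ∧ (J ∩ {s, t}).card = 1 := by
  simp only [card_inter_pair_eq_one_iff hadj.ne]
  obtain ⟨J, hJ, hcut⟩ := hp.exists_cut hB hadj hI h
  exact ⟨J, ⟨hJ, hcut⟩, fun K hK => hp.cut_unique hB hadj hK.1 hJ hK.2 hcut⟩

/-- On an arc of `B` and the vertex before it, the depth changes parity at each step. -/
theorem gCount_mod_two (hp : CycleParam G N p) (hB : B ∈ phi G) {a : ℤ} {k : ℕ}
    (hI : arc p a k ∈ B) {i : ℕ} (hi : i ≤ k) :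
    gCount B (p (a - 1 + i)) % 2 = (gCount B (p (a - 1)) + i) % 2 := by
  induction i with
  | zero => simp
  | succ i ih =>
    -- Positive depth on the arc excludes the case where both ends of the edge have depth 0.
    have hpos : gCount B (p (a - 1 + (i + 1 : ℕ))) ≠ 0 := fun h =>
      notMem_of_gCount_eq_zero h hI (mem_arc_of_le (by omega) (by omega))
    have h := ih (by omega)
    have hadj := hp.adj_succ (a - 1 + i)
    rw [add_assoc, ← Nat.cast_add_one] at hadj
    rcases hp.gCount_adj hB hadj with h' | h' | h' <;> omega

theorem subset_of_cut (hp : CycleParam G N p) (hB : B ∈ phi G) (hI : I ∈ B) (hJ : J ∈ B)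
    (hcut : ¬ (s ∈ I ↔ t ∈ I)) (hsJ : s ∈ J) (htJ : t ∈ J) : I ⊆ J := by
  have hmeet : ∃ u ∈ I, u ∈ J := by
    by_cases hs : s ∈ I
    · exact ⟨s, hs, hsJ⟩
    · exact ⟨t, by tauto, htJ⟩
  rcases hp.trichotomy hB hI hJ (Or.inl hmeet) with h | h | h
  · exact h.subset
  · exact h.1.1
  · exact absurd (iff_of_true (h.1.1 hsJ) (h.1.1 htJ)) hcut

theorem gCount_insert (hI : I ∉ B) (s : S) :
    gCount (insert I B) s = gCount B s + if s ∈ I then 1 else 0 := by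
  unfold gCount
  rw [Finset.filter_insert]
  split_ifs with h
  · exact Finset.card_insert_of_notMem fun h' => hI (Finset.mem_filter.1 h').1
  · rfl

/-- A member of `φ` is determined by the family without its member cutting an edge, as soon as
that edge lies in some member. -/
theorem eq_of_insert_mem_phi (hp : CycleParam G N p) {C : Finset (Finset S)} {I' : Finset S}
    (hIC : I ∉ C) (hIC' : I' ∉ C) (hB : insert I C ∈ phi G) (hB' : insert I' C ∈ phi G)
    (hcut : ¬ (s ∈ I ↔ t ∈ I)) (hcut' : ¬ (s ∈ I' ↔ t ∈ I')) (hJ : J ∈ C) (hsJ : s ∈ J)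
    (htJ : t ∈ J) : I = I' := by
  have hIJ := hp.subset_of_cut hB (Finset.mem_insert_self _ _) (Finset.mem_insert_of_mem hJ)
    hcut hsJ htJ
  have hIJ' := hp.subset_of_cut hB' (Finset.mem_insert_self _ _) (Finset.mem_insert_of_mem hJ)
    hcut' hsJ htJ
  obtain ⟨a, k, hk, hkN, rfl⟩ := hp.exists_eq_arc hB (Finset.mem_insert_of_mem hJ)
  have hpred := hp.notMem_arc_pred (a := a) hkN
  -- Both candidates lie inside `J`, so at the vertex before `J` both families have the depth of
  -- `C`.
  have h0 := gCount_insert hIC (p (a - 1))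
  have h0' := gCount_insert hIC' (p (a - 1))
  rw [if_neg fun h => hpred (hIJ h)] at h0
  rw [if_neg fun h => hpred (hIJ' h)] at h0'
  have key : ∀ u ∈ arc p a k, (u ∈ I ↔ u ∈ I') := by
    intro u hu
    obtain ⟨i, hi, rfl⟩ := mem_arc.1 hu
    have hidx : a + i = a - 1 + (i + 1 : ℕ) := by omega
    rw [hidx]
    have h1 := hp.gCount_mod_two hB (Finset.mem_insert_of_mem hJ) (i := i + 1) (by omega)
    have h1' := hp.gCount_mod_two hB' (Finset.mem_insert_of_mem hJ) (i := i + 1) (by omega)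
    -- The parity at `u` is the same for both families, and so is the contribution of `C`; hence the
    -- two indicators agree.
    rw [gCount_insert hIC, h0] at h1
    rw [gCount_insert hIC', h0'] at h1'
    split_ifs at h1 h1' with h2 h3 h3
    · exact iff_of_true h2 h3
    · omega
    · omega
    · exact iff_of_false h2 h3
  ext u
  exact ⟨fun h => (key u (hIJ h)).1 h, fun h => (key u (hIJ' h)).2 h⟩

theorem exists_bang_eq_erase (hp : CycleParam G N p) (hB : B ∈ phi G) (hadj : G.Adj s t)
    (hn : Odd (nCount {s, t} B)) :
    ∃ I ∈ B, ¬ (s ∈ I ↔ t ∈ I) ∧ bang {s, t} B = B.erase I ∧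
      ∃ J ∈ bang {s, t} B, s ∈ J ∧ t ∈ J := by
  obtain ⟨J, hJ⟩ := Finset.card_pos.1 hn.pos
  simp only [Finset.mem_filter, Finset.insert_subset_iff, Finset.singleton_subset_iff] at hJ
  obtain ⟨hJ, hsJ, htJ⟩ := hJ
  obtain ⟨I, hI, hcut⟩ := hp.exists_cut hB hadj hJ (Or.inl hsJ)
  have hbang : bang {s, t} B = B.erase I := by
    ext K
    simp only [bang, if_pos hn, Finset.mem_sdiff, Finset.mem_filter, Finset.mem_erase,
      card_inter_pair_eq_one_iff hadj.ne]
    constructor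
    · rintro ⟨hK, h⟩
      exact ⟨fun hKI => h ⟨hK, hKI ▸ hcut⟩, hK⟩
    · rintro ⟨hne, hK⟩
      exact ⟨hK, fun h => hne (hp.cut_unique hB hadj hK hI h.2 hcut)⟩
  refine ⟨I, hI, hcut, hbang, J, ?_, hsJ, htJ⟩
  rw [hbang, Finset.mem_erase]
  exact ⟨fun h => hcut (iff_of_true (h ▸ hsJ) (h ▸ htJ)), hJ⟩

/-- The count `nCount` survives `bang`, so both families fall in the same case. In the odd case a
member containing the edge also survives, as `eq_of_insert_mem_phi` requires. -/
theorem bang_injOn (hp : CycleParam G N p) (hadj : G.Adj s t) :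
    Set.InjOn (bang {s, t}) (phi G) := by
  intro B hB B' hB' h
  have hn : nCount {s, t} B = nCount {s, t} B' := by
    rw [← nCount_bang hadj.ne, h, nCount_bang hadj.ne]
  by_cases hodd : Odd (nCount {s, t} B)
  · obtain ⟨I, hI, hcut, he, J, hJ, hsJ, htJ⟩ := hp.exists_bang_eq_erase hB hadj hodd
    obtain ⟨I', hI', hcut', he', -⟩ := hp.exists_bang_eq_erase hB' hadj (hn ▸ hodd)
    have hB1 : insert I (bang {s, t} B) = B := by rw [he, Finset.insert_erase hI]
    have hB2 : insert I' (bang {s, t} B) = B' := by rw [h, he', Finset.insert_erase hI']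
    have hII : I = I' := by
      refine hp.eq_of_insert_mem_phi (C := bang {s, t} B) ?_ ?_ (hB1.symm ▸ hB) (hB2.symm ▸ hB')
        hcut hcut' hJ hsJ htJ
      · rw [he]
        exact Finset.notMem_erase _ _
      · rw [h, he']
        exact Finset.notMem_erase _ _
    rw [← hB1, ← hB2, hII]
  · rwa [bang, bang, if_neg hodd, if_neg (hn ▸ hodd)] at h

end CycleParam

end Bang

/-! ### Coordinates in the quotient and the partial order. -/

section Order

variable {S V : Type*} [Fintype S] [DecidableEq S] [AddCommGroup V] [Module (ZMod 2) V]
  {e : Module.Basis S (ZMod 2) V}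

/-- Coordinates of the relation `ε(B') ∈ ⟨B⟩`. -/
theorem exists_tri_gCount_eq_of_eps_mem_spanOf {B B' : Finset (Finset S)}
    (h : eps (barVec e) B' ∈ spanOf (barVec e) B) :
    ∃ (f : Finset S → ZMod 2) (c : ZMod 2),
      ∀ s, tri (gCount B' s) = c + ∑ I ∈ B, if s ∈ I then f I else 0 := by
  obtain ⟨f, hf⟩ := (Submodule.mem_span_image_finset_iff_exists_fun _).1 h
  let f' : Finset S → ZMod 2 := fun I => if hI : I ∈ B then f ⟨I, hI⟩ else 0
  have hf' : ∑ I ∈ B, f' I • vec (barVec e) I = eps (barVec e) B' := by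
    rw [← hf, ← Finset.sum_coe_sort]
    refine Finset.sum_congr rfl fun I _ => ?_
    simp [f']
  have hbar : ∀ I : Finset S, vec (barVec e) I = (line e).mkQ (vec e I) := by
    intro I
    rw [vec, vec, map_sum]
    rfl
  have heps : eps (barVec e) B' = (line e).mkQ (∑ s, tri (gCount B' s) • e s) := by
    rw [eps, map_sum]
    exact Finset.sum_congr rfl fun s _ => ((line e).mkQ.map_smul _ _).symm
  simp only [hbar, heps, ← map_smul, ← map_sum] at hf'
  -- Equality in the quotient lifts to `V` up to a multiple `c` of e_S, the source of the additive
  -- constant.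
  rw [eq_comm, ← sub_eq_zero, ← map_sub, ← LinearMap.mem_ker, Submodule.ker_mkQ, line,
    Submodule.mem_span_singleton] at hf'
  obtain ⟨c, hc⟩ := hf'
  have hrepr : ∀ (I : Finset S) s, e.repr (vec e I) s = if s ∈ I then 1 else 0 := by
    intro I s
    simp [vec, Finsupp.single_apply]
  refine ⟨f', c, fun s => ?_⟩
  have h1 : e.repr (∑ s, tri (gCount B' s) • e s) s = tri (gCount B' s) := by
    rw [e.repr_sum_self]
  have h2 := congrArg (fun v => e.repr v s) hc
  simp only [map_sub, map_smul, map_sum, Finsupp.sub_apply, Finsupp.smul_apply,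
    Finsupp.finsetSum_apply, hrepr, smul_eq_mul, mul_ite, mul_one, mul_zero, Finset.mem_univ,
    if_true] at h2
  rw [← h1]
  simp only [map_smul, map_sum, Finsupp.smul_apply, Finsupp.finsetSum_apply]
  simp only [smul_eq_mul]
  rw [h2]
  ring

variable {G : SimpleGraph S} {N : ℕ} {p : ℤ → S} {ed : Finset S}

/-- Passing from `B` to the larger family `tilde G ed B` enlarges the span, so the comparison inside
`phi G` applies. -/
theorem CycleParam.gCount_tilde_le_of_mem (hp : CycleParam G N p) {B B' : omega G ed}
    (h : epsPrime (barVec e) G ed B' ∈ spanOf (barVec e) (B : Finset (Finset S))) (s : S) :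
    gCount (tilde G ed B') s ≤ gCount (tilde G ed B) s := by
  have hsub : (B : Finset (Finset S)) ⊆ tilde G ed B := by
    rw [← bang_tilde G ed B]
    exact bang_subset ed _
  have h' : eps (barVec e) (tilde G ed B') ∈ spanOf (barVec e) (tilde G ed B) :=
    Submodule.span_mono (Set.image_mono (Finset.coe_subset.2 hsub)) h
  obtain ⟨f, c, hT⟩ := exists_tri_gCount_eq_of_eps_mem_spanOf h'
  exact hp.gCount_le (tilde_mem G ed B) (tilde_mem G ed B') hT s

theorem CycleParam.gCount_tilde_le (hp : CycleParam G N p) {B B' : omega G ed}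
    (h : PrecEq (barVec e) G ed B' B) (s : S) :
    gCount (tilde G ed B') s ≤ gCount (tilde G ed B) s := by
  obtain ⟨k, c, rfl, rfl, hc⟩ := h
  induction k with
  | zero => exact le_rfl
  | succ k ih =>
    exact (ih fun i hi => hc i (by omega)).trans
      (hp.gCount_tilde_le_of_mem (hc k (by omega)) s)

theorem CycleParam.isPartialOrder_precEq (hp : CycleParam G N p) :
    IsPartialOrder (omega G ed) (PrecEq (barVec e) G ed) where
  refl B := ⟨0, fun _ => B, rfl, rfl, fun i hi => absurd hi (Nat.not_lt_zero i)⟩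
  trans := by
    rintro A B C ⟨k, c, rfl, rfl, hc⟩ ⟨l, d, hd, rfl, hd'⟩
    refine ⟨k + l, fun i => if i ≤ k then c i else d (i - k), by simp, ?_, fun i hi => ?_⟩
    -- For `l = 0` the final index `k` still falls in the first branch, and `hd` identifies the two
    -- chains there.
    · rcases Nat.eq_zero_or_pos l with rfl | hl
      · simp [hd]
      · dsimp only
        rw [if_neg (by omega), Nat.add_sub_cancel_left]
    · dsimp only
      rcases lt_trichotomy i k with h | rfl | h
      · rw [if_pos h.le, if_pos (by omega)]
        exact hc i h
      · rw [if_pos le_rfl, if_neg (by omega), Nat.add_sub_cancel_left, ← hd]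
        exact hd' 0 (by omega)
      · rw [if_neg (by omega), if_neg (by omega), Nat.sub_add_comm h.le]
        exact hd' (i - k) (by omega)
  antisymm B B' h h' := by
    have heq : ∀ s, gCount (tilde G ed B) s = gCount (tilde G ed B') s := fun s =>
      (hp.gCount_tilde_le h s).antisymm (hp.gCount_tilde_le h' s)
    have hB := tilde_mem G ed B
    have hB' := tilde_mem G ed B'
    have ht : tilde G ed B = tilde G ed B' :=
      (hp.subset_of_gCount_eq hB hB' heq).antisymm
        (hp.subset_of_gCount_eq hB' hB fun s => (heq s).symm)
    exact Subtype.ext (by rw [← bang_tilde G ed B, ← bang_tilde G ed B', ht])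

end Order

end CircularFamily

theorem mainTheorem7 {S V : Type*} [Fintype S] [DecidableEq S] [AddCommGroup V]
    [Module (ZMod 2) V] (β : LinearMap.BilinForm (ZMod 2) V) (e : Module.Basis S (ZMod 2) V)
    (h : IsAffineA β e) (ed : Finset S) (hed : ∃ s s' : S, h.graph.Adj s s' ∧ ed = {s, s'}) :
    (∀ B ∈ phi h.graph, (supp B ∩ ed).Nonempty → ∃! I, I ∈ B ∧ (I ∩ ed).card = 1) ∧
    Set.InjOn (bang ed) (phi h.graph) ∧
    IsPartialOrder (omega h.graph ed) (PrecEq (barVec e) h.graph ed) := by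
  obtain ⟨s, t, hadj, rfl⟩ := hed
  obtain ⟨N, h3, hodd, ⟨f⟩⟩ := h.isCycle
  -- The induced form on the ē_s has by definition the values of `β` on the e_s, so `f` also serves
  -- for `h.graph`.
  obtain ⟨p, hp⟩ : ∃ p, CycleParam h.graph N p := exists_cycleParam h3 hodd f
  refine ⟨fun B hB hne => ?_, hp.bang_injOn hadj, hp.isPartialOrder_precEq⟩
  obtain ⟨u, hu⟩ := hne
  rw [Finset.mem_inter, supp, Finset.mem_biUnion, Finset.mem_insert, Finset.mem_singleton] at hu
  obtain ⟨⟨I, hI, huI⟩, rfl | rfl⟩ := hu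
  · exact hp.existsUnique_cut hB hadj hI (Or.inl huI)
  · exact hp.existsUnique_cut hB hadj hI (Or.inr huI)
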